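/- All graphs are finite and simple. Let $G$ be a connected graph with graph distance $d$. A path of $G$ is isometric if it is a shortest path between its end-vertices, and it is $r$-rooted if $r$ is one of its end-vertices. For a vertex $r$, let $\mathrm{ipco}_r(G)$ be the minimum $k$ such that the vertices of any isometric path of $G$ can be covered by $k$ many $r$-rooted isometric paths of $G$. The strong isometric path complexity of $G$ is the minimum $k$ such that, for every vertex $r$ of $G$, the vertices of any isometric path of $G$ can be covered by $k$ many $r$-rooted isometric paths. Let $\overrightarrow{G_r}$ be the BFS DAG of $G$ from $r$: its arcs are the pairs $(x,y)$ such that $xy$ is an edge of $G$ and $d(r,y)=d(r,x)-1$. An antichain set is a set of vertices such that, for any two distinct vertices of it, $\overrightarrow{G_r}$ has no directed path from one to the other in either direction. Let $\mathrm{ipac}(\overrightarrow{G_r})$ be the maximum size of an antichain set contained in the vertex set of some isometric path of $G$. A $K$-fat minor model of a graph $H$ in $G$ consists of connected subgraphs $B_v$ ($v\in V(H)$) and $P_e$ ($e\in E(H)$) of $G$ such that $V(B_v)\cap V(P_e)\ne\emptyset$ whenever $v$ is an end-vertex of $e$, and any two other distinct members of the family are at distance at least $K$ in $G$. If such a model exists,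 $G$ contains $H$ as a $K$-fat minor. Let $U_t$ be the graph consisting of a path on $t$ vertices and one further vertex adjacent to all of them. **Theorem.** (1) There is a function $f\colon\mathbb N\times\mathbb N\to\mathbb N$ such that, for all $K,t$, every connected graph that does not contain $U_t$ as a $K$-fat minor has strong isometric path complexity at most $f(K,t)$. (2) Let $t\ge 2$ and $K\ge 5$ be integers. If a connected graph $G$ does not contain $U_t$ as a $K$-fat minor, then for every vertex $r$ of $G$, $$\mathrm{ipac}(\overrightarrow{G_r})\le(12K+5)t-1\qquad\text{and}\qquad \mathrm{ipco}_r(G)\le(12K+5)t-1 .$$ -/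

import Mathlib

namespace CoarseGraph

universe u v

/-- The graph `U_t`: a path on the `t` vertices `some 0, …, some (t - 1)`, together with a universal
vertex `none`. -/
def fan (t : ℕ) : SimpleGraph (Option (Fin t)) where
  Adj
    | none, none => False
    | none, some _ => True
    | some _, none => True
    | some i, some j => (SimpleGraph.pathGraph t).Adj i j
  symm := ⟨by
    rintro (_ | i) (_ | j) h
    · exact h
    · trivial
    · trivial
    · exact SimpleGraph.Adj.symm h⟩
  loopless := ⟨by
    rintro (_ | i) h
    · exact h
    · exact (SimpleGraph.pathGraph t).irrefl h⟩

/-- The subgraphs `X` and `Y` of `G` are at distance at least `K` in `G`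
(`SimpleGraph.edist` is the graph distance, infinite between different components). -/
def FarApart {V : Type u} (G : SimpleGraph V) (K : ℕ) (X Y : G.Subgraph) : Prop :=
  ∀ x ∈ X.verts, ∀ y ∈ Y.verts, (K : ℕ∞) ≤ G.edist x y

/-- A `K`-fat minor model of `H` in `G`: connected subgraphs of `G`, namely branch sets indexed by the
vertices of `H` and branch paths indexed by the edges of `H`, such that an incident branch set and
branch path intersect, and any two other distinct members are at distance at least `K` in `G`. -/
structure FatMinorModel {W : Type v} {V : Type u} (K : ℕ) (H : SimpleGraph W)
    (G : SimpleGraph V) where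
  branchSet : W → G.Subgraph
  branchPath : H.edgeSet → G.Subgraph
  branchSet_connected : ∀ w, (branchSet w).Connected
  branchPath_connected : ∀ e, (branchPath e).Connected
  incident : ∀ (w : W) (e : H.edgeSet), w ∈ (e : Sym2 W) →
    ((branchSet w).verts ∩ (branchPath e).verts).Nonempty
  far_sets : ∀ w w' : W, w ≠ w' → FarApart G K (branchSet w) (branchSet w')
  far_paths : ∀ e e' : H.edgeSet, e ≠ e' → FarApart G K (branchPath e) (branchPath e')
  far_set_path : ∀ (w : W) (e : H.edgeSet), w ∉ (e : Sym2 W) →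
    FarApart G K (branchSet w) (branchPath e)

/-- `G` contains `H` as a `K`-fat minor. -/
def HasFatMinor {W : Type v} {V : Type u} (K : ℕ) (H : SimpleGraph W) (G : SimpleGraph V) : Prop :=
  Nonempty (FatMinorModel K H G)

/-- A path is isometric if it is a shortest path between its end-vertices. -/
def IsIsometricPath {V : Type u} {G : SimpleGraph V} {x y : V} (P : G.Walk x y) : Prop :=
  P.IsPath ∧ P.length = G.dist x y

/-- An `r`-rooted isometric path: `r` is one of the end-vertices. -/
def IsRootedIsometricPath {V : Type u} {G : SimpleGraph V} (r : V) {x y : V} (P : G.Walk x y) :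
    Prop :=
  IsIsometricPath P ∧ (r = x ∨ r = y)

/-- The vertices of any isometric path of `G` can be covered by `k` many `r`-rooted isometric
paths of `G`. -/
def RootCoverable {V : Type u} (G : SimpleGraph V) (r : V) (k : ℕ) : Prop :=
  ∀ (x y : V) (P : G.Walk x y), IsIsometricPath P →
    ∃ (a b : Fin k → V) (Q : ∀ i, G.Walk (a i) (b i)),
      (∀ i, IsRootedIsometricPath r (Q i)) ∧ ∀ z ∈ P.support, ∃ i, z ∈ (Q i).support

/-- The covering number of `G` with respect to the root `r`: the minimum `k` such that any isometric
path of `G` can be covered by `k` many `r`-rooted isometric paths (`⊤` if there is no such `k`). -/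
noncomputable def rootCoverNumber {V : Type u} (G : SimpleGraph V) (r : V) : ℕ∞ :=
  ⨅ (k : ℕ) (_ : RootCoverable G r k), (k : ℕ∞)

/-- The strong isometric path complexity: the minimum `k` such that for every vertex `r` any
isometric path of `G` can be covered by `k` many `r`-rooted isometric paths (`⊤` if there is no
such `k`). -/
noncomputable def strongIsometricPathComplexity {V : Type u} (G : SimpleGraph V) : ℕ∞ :=
  ⨅ (k : ℕ) (_ : ∀ r : V, RootCoverable G r k), (k : ℕ∞)

/-- The BFS digraph of `G` from `r`: edges between vertices at equal distance from `r` are dropped,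
and each other edge is directed towards its end-vertex closer to `r`. -/
def bfsDag {V : Type u} (G : SimpleGraph V) (r : V) : Digraph V where
  Adj x y := G.Adj x y ∧ G.dist r y + 1 = G.dist r x

/-- There is a directed path from `x` to `y` in the digraph `D`. -/
def HasDirectedPath {V : Type u} (D : Digraph V) (x y : V) : Prop :=
  Relation.ReflTransGen D.Adj x y

/-- A set of vertices is an antichain set of the digraph `D` if no directed path of `D` joins two
different vertices of it, in either direction. -/
def IsAntichainSet {V : Type u} (D : Digraph V) (S : Set V) : Prop :=
  ∀ x ∈ S, ∀ y ∈ S, x ≠ y → ¬ HasDirectedPath D x y ∧ ¬ HasDirectedPath D y x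

/-- The antichain number of a path `P` in the digraph `D`: the maximum size of an antichain set of
`D` consisting of vertices of `P`. -/
noncomputable def pathAntichainNumber {V : Type u} (D : Digraph V) {G : SimpleGraph V} {x y : V}
    (P : G.Walk x y) : ℕ∞ :=
  ⨆ (S : Set V) (_ : (∀ z ∈ S, z ∈ P.support) ∧ IsAntichainSet D S), S.encard

/-- The maximum, over all isometric paths `P` of `G`, of the antichain number of `P` in the BFS
digraph of `G` from `r`. -/
noncomputable def antichainNumber {V : Type u} (G : SimpleGraph V) (r : V) : ℕ∞ :=
  ⨆ (x : V) (y : V) (P : G.Walk x y) (_ : IsIsometricPath P), pathAntichainNumber (bfsDag G r) P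

end CoarseGraph

namespace CoarseGraph

/-! The defect `d(x,y) + d(r,y) - d(r,x)` is a directed pseudometric, bounded by `2 d(x,y)`, that
vanishes along every geodesic descending to `r`. A large defect thus certifies distance, and it
survives sliding its source down such a geodesic.

On an isometric path `P`, consider positions between which `d(r,·)` changes less than the position
does. Each consecutive pair adds at least one to the defect in both directions. With `(12K+5)t` such
positions, `P` splits into `t` blocks. A geodesic runs from a centre of each block to `r`; these
geodesics are cut shortly after they last come close to their own segments. The tails form the hub,
the next `K` steps the spokes, and the starts together with the segments of `P` the rim vertices
(`hasFatMinor_fan_of_isAntichainSeq`).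

Without a fat fan there is no such sequence. An antichain on `P`, sorted by position, is one
(`exists_isAntichainSeq`). A greedy search along `P` yields either one or a cover of `P` by fewer
monotone pieces, each extending to an `r`-rooted geodesic (`exists_strict_seq_or_interval_cover`).
-/

variable {V : Type*} {G : SimpleGraph V}

/-! ### The root defect along geodesics -/

/-- The amount by which the concatenation of a shortest path from `x` to `y` and a shortest path from
`y` to `r` is longer than a shortest path from `x` to `r`. -/
noncomputable def rootDefect (G : SimpleGraph V) (r x y : V) : ℤ :=
  G.dist x y + G.dist r y - G.dist r x

theorem rootDefect_triangle (hG : G.Connected) (r x y z : V) :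
    rootDefect G r x z ≤ rootDefect G r x y + rootDefect G r y z := by
  have := hG.dist_triangle (u := x) (v := y) (w := z)
  unfold rootDefect
  omega

theorem rootDefect_le_two_mul_dist (hG : G.Connected) (r x y : V) :
    rootDefect G r x y ≤ 2 * G.dist x y := by
  have := hG.dist_triangle (u := r) (v := x) (w := y)
  unfold rootDefect
  omega

theorem getVert_succ_eq_or_adj {x y : V} (w : G.Walk x y) (i : ℕ) :
    w.getVert i = w.getVert (i + 1) ∨ G.Adj (w.getVert i) (w.getVert (i + 1)) := by
  rcases lt_or_ge i w.length with h | h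
  · exact Or.inr (w.adj_getVert_succ h)
  · left
    rw [w.getVert_of_length_le h, w.getVert_of_length_le (by omega)]

theorem dist_getVert_le (hG : G.Connected) {x y : V} (w : G.Walk x y) {i j : ℕ} (hij : i ≤ j) :
    G.dist (w.getVert i) (w.getVert j) ≤ j - i := by
  induction j, hij using Nat.le_induction with
  | base => simp
  | succ j hij ih =>
    rcases getVert_succ_eq_or_adj w j with h | h
    · rw [← h]; omega
    · have h1 := hG.dist_triangle (u := w.getVert i) (v := w.getVert j) (w := w.getVert (j + 1))
      have h2 := SimpleGraph.dist_eq_one_iff_adj.mpr h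
      omega

theorem dist_getVert (hG : G.Connected) {x y : V} (w : G.Walk x y) (hw : w.length = G.dist x y)
    {i j : ℕ} (hij : i ≤ j) (hj : j ≤ w.length) :
    G.dist (w.getVert i) (w.getVert j) = j - i := by
  have h1 := dist_getVert_le hG w (Nat.zero_le i)
  have h2 := dist_getVert_le hG w hij
  have h3 := dist_getVert_le hG w hj
  rw [w.getVert_zero] at h1
  rw [w.getVert_length] at h3
  have h4 := hG.dist_triangle (u := x) (v := w.getVert i) (w := y)
  have h5 := hG.dist_triangle (u := w.getVert i) (v := w.getVert j) (w := y)
  omega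

theorem rootDefect_getVert (hG : G.Connected) {c r : V} (w : G.Walk c r)
    (hw : w.length = G.dist c r) {i j : ℕ} (hij : i ≤ j) :
    rootDefect G r (w.getVert i) (w.getVert j) = 0 := by
  have key : ∀ {i j : ℕ}, i ≤ j → j ≤ w.length →
      rootDefect G r (w.getVert i) (w.getVert j) = 0 := by
    intro i j hij hj
    have h1 := dist_getVert hG w hw hij hj
    have h2 := dist_getVert hG w hw (hij.trans hj) le_rfl
    have h3 := dist_getVert hG w hw hj le_rfl
    rw [w.getVert_length, SimpleGraph.dist_comm] at h2 h3
    unfold rootDefect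
    omega
  -- `getVert` stays at `r` beyond the end of the walk, so no bound on the indices is needed.
  rcases le_total j w.length with hj | hj
  · exact key hij hj
  · rw [w.getVert_of_length_le hj]
    rcases le_total i w.length with hi | hi
    · simpa using key hi le_rfl
    · rw [w.getVert_of_length_le hi]
      simp [rootDefect]

theorem induce_image_Icc_connected {f : ℕ → V} (hf : ∀ i, f i = f (i + 1) ∨ G.Adj (f i) (f (i + 1)))
    {a b : ℕ} (hab : a ≤ b) : (G.induce (f '' Set.Icc a b)).Connected := by
  have hsing (x : V) : (G.induce {x}).Preconnected :=
    SimpleGraph.Preconnected.of_subsingleton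
  induction b, hab using Nat.le_induction with
  | base =>
    rw [Set.Icc_self, Set.image_singleton]
    exact ⟨hsing _⟩
  | succ b hab ih =>
    have hins : Set.Icc a (b + 1) = insert (b + 1) (Set.Icc a b) := by
      ext x; simp only [Set.mem_Icc, Set.mem_insert_iff]; omega
    have hb : f b ∈ f '' Set.Icc a b := ⟨b, ⟨hab, le_rfl⟩, rfl⟩
    rw [hins, Set.image_insert_eq]
    rcases hf b with h | h
    · rwa [← h, Set.insert_eq_of_mem hb]
    · rw [Set.insert_eq]
      exact SimpleGraph.connected_induce_union (hsing _) ih.preconnected rfl hb h.symm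

/-! ### Fan models from vertex sets -/

theorem edge_fan_cases {t : ℕ} (e : Sym2 (Option (Fin t))) (he : e ∈ (fan t).edgeSet) :
    (∃ (i : ℕ) (hi : i < t), e = s(none, some ⟨i, hi⟩)) ∨
      ∃ (i : ℕ) (hi : i + 1 < t), e = s(some ⟨i, by omega⟩, some ⟨i + 1, hi⟩) := by
  induction e using Sym2.ind with
  | _ x y =>
    rw [SimpleGraph.mem_edgeSet] at he
    rcases x with _ | i <;> rcases y with _ | j
    · exact he.elim
    · exact Or.inl ⟨j, j.2, rfl⟩
    · exact Or.inl ⟨i, i.2, Sym2.eq_swap⟩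
    · right
      have h : (SimpleGraph.pathGraph t).Adj i j := he
      rw [SimpleGraph.pathGraph_adj] at h
      rcases h with h | h
      · exact ⟨i, by omega, congrArg (fun z => s(some i, some z)) (Fin.ext h.symm)⟩
      · refine ⟨j, by omega, ?_⟩
        rw [Sym2.eq_swap]
        exact congrArg (fun z => s(some j, some z)) (Fin.ext h.symm)

/-- The vertex sets `X` and `Y` are at distance at least `K`. -/
def SetsFar (G : SimpleGraph V) (K : ℕ) (X Y : Set V) : Prop :=
  ∀ x ∈ X, ∀ y ∈ Y, K ≤ G.dist x y

theorem SetsFar.symm {K : ℕ} {X Y : Set V} (h : SetsFar G K X Y) : SetsFar G K Y X :=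
  fun y hy x hx => SimpleGraph.dist_comm (G := G) ▸ h x hx y hy

theorem SetsFar.farApart (hG : G.Connected) {K : ℕ} {X Y : Set V} (h : SetsFar G K X Y) :
    FarApart G K ((⊤ : G.Subgraph).induce X) ((⊤ : G.Subgraph).induce Y) := by
  intro x hx y hy
  rw [← (hG x y).coe_dist_eq_edist]
  exact_mod_cast h x hx y hy

theorem SetsFar.union_left {K : ℕ} {X Y Z : Set V} (h : SetsFar G K X Z) (h' : SetsFar G K Y Z) :
    SetsFar G K (X ∪ Y) Z := by
  rintro x (hx | hx)
  exacts [h x hx, h' x hx]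

theorem SetsFar.union_right {K : ℕ} {X Y Z : Set V} (h : SetsFar G K X Y) (h' : SetsFar G K X Z) :
    SetsFar G K X (Y ∪ Z) :=
  (h.symm.union_left h'.symm).symm

/-- A fat minor model of a fan given by the vertex sets of the hub `H`, of the branch sets `B i` of
the path vertices, of the spokes `S i` and of the rim edges `R i`. -/
theorem hasFatMinor_fan_of_sets (hG : G.Connected) {K t : ℕ} (H : Set V) (B S R : ℕ → Set V)
    (hH : (G.induce H).Connected) (hB : ∀ i < t, (G.induce (B i)).Connected)
    (hS : ∀ i < t, (G.induce (S i)).Connected)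
    (hR : ∀ i, i + 1 < t → (G.induce (R i)).Connected)
    (hHS : ∀ i < t, (H ∩ S i).Nonempty) (hBS : ∀ i < t, (B i ∩ S i).Nonempty)
    (hBR : ∀ i, i + 1 < t → (B i ∩ R i).Nonempty)
    (hBR' : ∀ i, i + 1 < t → (B (i + 1) ∩ R i).Nonempty)
    (fHB : ∀ i < t, SetsFar G K H (B i))
    (fBB : ∀ i < t, ∀ j < t, i ≠ j → SetsFar G K (B i) (B j))
    (fSS : ∀ i < t, ∀ j < t, i ≠ j → SetsFar G K (S i) (S j))
    (fRR : ∀ i j, i + 1 < t → j + 1 < t → i ≠ j → SetsFar G K (R i) (R j))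
    (fSR : ∀ i j, i < t → j + 1 < t → SetsFar G K (S i) (R j))
    (fHR : ∀ j, j + 1 < t → SetsFar G K H (R j))
    (fBS : ∀ i < t, ∀ j < t, i ≠ j → SetsFar G K (B i) (S j))
    (fBR : ∀ i j, i < t → j + 1 < t → i ≠ j → i ≠ j + 1 → SetsFar G K (B i) (R j)) :
    HasFatMinor K (fan t) G := by
  classical
  -- The code `c` of an edge is `inl i` for the `i`-th spoke and `inr i` for the `i`-th rim edge.
  have hex : ∀ e : (fan t).edgeSet, ∃ c : ℕ ⊕ ℕ,
      (∃ (i : ℕ) (hi : i < t), e.1 = s(none, some ⟨i, hi⟩) ∧ c = Sum.inl i) ∨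
      ∃ (i : ℕ) (hi : i + 1 < t), e.1 = s(some ⟨i, by omega⟩, some ⟨i + 1, hi⟩) ∧
        c = Sum.inr i := by
    rintro ⟨e, he⟩
    rcases edge_fan_cases e he with ⟨i, hi, h⟩ | ⟨i, hi, h⟩
    · exact ⟨_, Or.inl ⟨i, hi, h, rfl⟩⟩
    · exact ⟨_, Or.inr ⟨i, hi, h, rfl⟩⟩
  choose c hc using hex
  refine ⟨{
    branchSet := fun w => (⊤ : G.Subgraph).induce (w.elim H fun i => B i)
    branchPath := fun e => (⊤ : G.Subgraph).induce (Sum.elim S R (c e))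
    branchSet_connected := ?_
    branchPath_connected := ?_
    incident := ?_
    far_sets := ?_
    far_paths := ?_
    far_set_path := ?_ }⟩
  · rintro (_ | i)
    · exact SimpleGraph.connected_induce_iff.mp hH
    · exact SimpleGraph.connected_induce_iff.mp (hB i i.2)
  · intro e
    rcases hc e with ⟨i, hi, -, h⟩ | ⟨i, hi, -, h⟩ <;> rw [h]
    · exact SimpleGraph.connected_induce_iff.mp (hS i hi)
    · exact SimpleGraph.connected_induce_iff.mp (hR i hi)
  · intro w e hw
    rcases hc e with ⟨i, hi, he, h⟩ | ⟨i, hi, he, h⟩ <;> rw [h] <;>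
      rw [he, Sym2.mem_iff] at hw <;> rcases hw with rfl | rfl
    · exact hHS i hi
    · exact hBS i hi
    · exact hBR i hi
    · exact hBR' i hi
  · rintro (_ | i) (_ | j) hij
    · exact absurd rfl hij
    · exact (fHB j j.2).farApart hG
    · exact (fHB i i.2).symm.farApart hG
    · exact (fBB i i.2 j j.2 fun h => hij (by rw [Fin.ext h])).farApart hG
  · intro e e' hne
    rcases hc e with ⟨i, hi, he, h⟩ | ⟨i, hi, he, h⟩ <;>
      rcases hc e' with ⟨j, hj, he', h'⟩ | ⟨j, hj, he', h'⟩ <;> rw [h, h']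
    · exact (fSS i hi j hj fun hij => hne (Subtype.ext (by subst hij; rw [he, he']))).farApart hG
    · exact (fSR i j hi hj).farApart hG
    · exact (fSR j i hj hi).symm.farApart hG
    · exact (fRR i j hi hj fun hij => hne (Subtype.ext (by subst hij; rw [he, he']))).farApart hG
  · intro w e hw
    rcases hc e with ⟨j, hj, he, h⟩ | ⟨j, hj, he, h⟩ <;> rw [h] <;>
      rw [he, Sym2.mem_iff, not_or] at hw <;> rcases w with _ | i
    · exact absurd rfl hw.1
    · exact (fBS i i.2 j hj fun hij => hw.2 (congrArg some (Fin.ext hij))).farApart hG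
    · exact (fHR j hj).farApart hG
    · exact (fBR i j i.2 hj (fun hij => hw.1 (congrArg some (Fin.ext hij)))
        fun hij => hw.2 (congrArg some (Fin.ext hij))).farApart hG

/-! ### Defects between segments of an isometric path -/

theorem rootDefect_nonneg (hG : G.Connected) (r x y : V) : 0 ≤ rootDefect G r x y := by
  have := hG.dist_triangle (u := r) (v := y) (w := x)
  rw [SimpleGraph.dist_comm (u := y)] at this
  unfold rootDefect
  omega

/-- The positions `a 0 < a 1 < ⋯ < a (N - 1)` on the walk `P` are such that the distance from `r`
changes less than the position between any two consecutive ones. -/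
structure IsAntichainSeq (r : V) {x y : V} (P : G.Walk x y) (N : ℕ) (a : ℕ → ℕ) : Prop where
  le_length : ∀ l < N, a l ≤ P.length
  up : ∀ l, l + 1 < N →
    G.dist r (P.getVert (a (l + 1))) + a l < G.dist r (P.getVert (a l)) + a (l + 1)
  down : ∀ l, l + 1 < N →
    G.dist r (P.getVert (a l)) + a l < G.dist r (P.getVert (a (l + 1))) + a (l + 1)

/-- The vertices of `P` between the positions `a lo` and `a hi`. -/
def segment {x y : V} (P : G.Walk x y) (a : ℕ → ℕ) (lo hi : ℕ) : Set V :=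
  P.getVert '' Set.Icc (a lo) (a hi)

namespace IsAntichainSeq

variable {r x y : V} {P : G.Walk x y} {N : ℕ} {a : ℕ → ℕ}

/-- Position minus and position plus the distance to `r` are integers that both increase strictly,
hence by at least one, at each step of the sequence. -/
theorem growth (h : IsAntichainSeq r P N a) {l m : ℕ} (hlm : l ≤ m) (hm : m < N) :
    a l ≤ a m ∧
    G.dist r (P.getVert (a m)) + a l + (m - l) ≤ G.dist r (P.getVert (a l)) + a m ∧
    G.dist r (P.getVert (a l)) + a l + (m - l) ≤ G.dist r (P.getVert (a m)) + a m := by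
  induction m, hlm using Nat.le_induction with
  | base => simp
  | succ m hlm ih =>
    have h1 := h.up m hm
    have h2 := h.down m hm
    have := ih (by omega)
    omega

/-- On an isometric path the two defects are the increments of position plus and of position minus
the distance to `r`. Between the segments `growth` contributes `k`; the pieces inside the segments
contribute nonnegative amounts. -/
theorem le_rootDefect (hG : G.Connected) (hP : P.length = G.dist x y) (h : IsAntichainSeq r P N a)
    {lo hi lo' hi' k : ℕ} (hk : hi + k ≤ lo') (hlo : lo' < N) (hhi : hi' < N) {z w : V}
    (hz : z ∈ segment P a lo hi) (hw : w ∈ segment P a lo' hi') :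
    (k : ℤ) ≤ rootDefect G r z w ∧ (k : ℤ) ≤ rootDefect G r w z := by
  obtain ⟨i, ⟨-, hi2⟩, rfl⟩ := hz
  obtain ⟨j, ⟨hj1, hj2⟩, rfl⟩ := hw
  have hj := hj2.trans (h.le_length _ hhi)
  obtain ⟨g1, g2, g3⟩ := h.growth (show hi ≤ lo' by omega) hlo
  have d1 := dist_getVert hG P hP (hi2.trans (g1.trans hj1)) hj
  have d2 := dist_getVert hG P hP hi2 (g1.trans (hj1.trans hj))
  have d3 := dist_getVert hG P hP hj1 hj
  have n1 := rootDefect_nonneg hG r (P.getVert i) (P.getVert (a hi))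
  have n2 := rootDefect_nonneg hG r (P.getVert (a hi)) (P.getVert i)
  have n3 := rootDefect_nonneg hG r (P.getVert (a lo')) (P.getVert j)
  have n4 := rootDefect_nonneg hG r (P.getVert j) (P.getVert (a lo'))
  unfold rootDefect at *
  rw [SimpleGraph.dist_comm (u := P.getVert (a hi))] at n2
  rw [SimpleGraph.dist_comm (v := P.getVert (a lo'))] at n4
  rw [SimpleGraph.dist_comm (u := P.getVert j)]
  omega

theorem setsFar_segment (hG : G.Connected) (hP : P.length = G.dist x y)
    (h : IsAntichainSeq r P N a) {lo hi lo' hi' K : ℕ} (hk : hi + 2 * K ≤ lo') (hlo : lo' < N)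
    (hhi : hi' < N) : SetsFar G K (segment P a lo hi) (segment P a lo' hi') := by
  intro z hz w hw
  have h1 := (h.le_rootDefect hG hP hk hlo hhi hz hw).1
  have h2 := rootDefect_le_two_mul_dist hG r z w
  omega

theorem segment_connected (h : IsAntichainSeq r P N a) {lo hi : ℕ} (hle : lo ≤ hi) (hhi : hi < N) :
    (G.induce (segment P a lo hi)).Connected :=
  induce_image_Icc_connected (getVert_succ_eq_or_adj P) (h.growth hle hhi).1

end IsAntichainSeq

/-! ### Geodesics descending to the root -/

/-- Far away from the start of a descending path is whatever has a large defect. -/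
theorem le_dist_of_le_rootDefect (hG : G.Connected) {c r z : V} (q : G.Walk c r)
    (hq : q.length = G.dist c r) {K : ℕ} (hz : (2 * K : ℕ) ≤ rootDefect G r c z) (s : ℕ) :
    K ≤ G.dist (q.getVert s) z := by
  have h1 := rootDefect_getVert hG q hq (Nat.zero_le s)
  rw [q.getVert_zero] at h1
  have h2 := rootDefect_triangle hG r c (q.getVert s) z
  have h3 := rootDefect_le_two_mul_dist hG r (q.getVert s) z
  omega

/-- Let `q` and `q'` be descending paths such that `q` comes close to `z` at position `l`, and `z` has a
large defect from the start of `q'`. Then the part of `q` up to shortly after `l` is far from `q'`. -/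
theorem le_dist_of_le_rootDefect_of_dist_lt (hG : G.Connected) {c c' r z : V} (q : G.Walk c r)
    (hq : q.length = G.dist c r) (q' : G.Walk c' r) (hq' : q'.length = G.dist c' r) {K l : ℕ}
    (hl : G.dist (q.getVert l) z < K) (hz : (6 * K : ℕ) ≤ rootDefect G r c' z) {s : ℕ}
    (hs : s ≤ l + K) (s' : ℕ) :
    K ≤ G.dist (q.getVert s) (q'.getVert s') := by
  have h1 := rootDefect_getVert hG q' hq' (Nat.zero_le s')
  rw [q'.getVert_zero] at h1
  -- Split the defect from `c'` to `z` at `q'(s')`, `q(s)` and `q(l)`. The four parts are at most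
  -- `0`, twice the wanted distance, `2K`, and less than `2K`.
  have h2 := rootDefect_triangle hG r c' (q'.getVert s') z
  have h3 := rootDefect_triangle hG r (q'.getVert s') (q.getVert s) z
  have h4 := rootDefect_triangle hG r (q.getVert s) (q.getVert l) z
  have h5 := rootDefect_le_two_mul_dist hG r (q.getVert l) z
  have h6 := rootDefect_le_two_mul_dist hG r (q'.getVert s') (q.getVert s)
  have h7 : rootDefect G r (q.getVert s) (q.getVert l) ≤ 2 * K := by
    rcases le_total s l with h | h
    · rw [rootDefect_getVert hG q hq h]; positivity
    · have h8 := rootDefect_le_two_mul_dist hG r (q.getVert s) (q.getVert l)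
      have h9 := dist_getVert_le hG q h
      rw [SimpleGraph.dist_comm] at h9
      omega
  rw [SimpleGraph.dist_comm] at h6
  omega

/-! ### Construction of the fat fan -/

theorem hasFatMinor_fan_of_isAntichainSeq (hG : G.Connected) {r x y : V} {P : G.Walk x y}
    (hP : P.length = G.dist x y) {K t : ℕ} (hK : 1 ≤ K) (ht : 2 ≤ t) {a : ℕ → ℕ}
    (ha : IsAntichainSeq r P ((12 * K + 5) * t) a) : HasFatMinor K (fan t) G := by
  obtain ⟨b, hb⟩ : ∃ b : ℕ → ℕ, b = fun i => (12 * K + 5) * i := ⟨_, rfl⟩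
  have hb1 (i : ℕ) : b (i + 1) = b i + (12 * K + 5) := by rw [hb]; ring
  have hbt (i : ℕ) (hi : i < t) : b i + (12 * K + 5) ≤ (12 * K + 5) * t := by
    rw [← hb1, hb]; exact Nat.mul_le_mul_left _ hi
  have hblt (i j : ℕ) (hij : i < j) : b i + (12 * K + 5) ≤ b j := by
    rw [← hb1, hb]; exact Nat.mul_le_mul_left _ hij
  generalize (12 * K + 5) * t = N at *
  set c : ℕ → V := fun i => P.getVert (a (b i + 2 * K)) with hc
  set seg : ℕ → Set V := fun i => segment P a (b i) (b i + 4 * K) with hseg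
  set rim : ℕ → Set V := fun i => segment P a (b i + 4 * K) (b (i + 1)) with hrim
  have hcmem (i : ℕ) : c i ∈ segment P a (b i + 2 * K) (b i + 2 * K) :=
    ⟨_, ⟨le_rfl, le_rfl⟩, rfl⟩
  have hcseg (i : ℕ) (hi : i < t) : c i ∈ seg i := by
    have := hbt i hi
    exact ⟨_, ⟨(ha.growth (by omega) (by omega)).1, (ha.growth (by omega) (by omega)).1⟩, rfl⟩
  -- The index gap from a centre to a foreign segment is at least `10K + 5`.
  have dseg (i j : ℕ) (hi : i < t) (hj : j < t) (hij : i ≠ j) (z : V) (hz : z ∈ seg i) :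
      ((6 * K : ℕ) : ℤ) ≤ rootDefect G r (c j) z := by
    have h1 := hbt i hi
    have h2 := hbt j hj
    rcases lt_or_gt_of_ne hij with h | h
    · have h3 := hblt i j h
      exact (ha.le_rootDefect hG hP (by omega) (by omega) (by omega) hz (hcmem j)).2
    · have h3 := hblt j i h
      exact (ha.le_rootDefect hG hP (by omega) (by omega) (by omega) (hcmem j) hz).1
  -- Each centre lies `2K` indices inside its segment, exactly what keeps its geodesic at distance
  -- `K` from every rim edge.
  have drim (i j : ℕ) (hi : i < t) (hj : j + 1 < t) (z : V) (hz : z ∈ rim j) :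
      ((2 * K : ℕ) : ℤ) ≤ rootDefect G r (c i) z := by
    have h1 := hbt i hi
    have h2 := hbt (j + 1) hj
    have h3 := hb1 j
    rcases lt_or_ge j i with h | h
    · have h4 : b (j + 1) ≤ b i := by
        rcases (show j + 1 ≤ i from h).eq_or_lt with h | h
        · rw [h]
        · have := hblt _ _ h; omega
      exact (ha.le_rootDefect hG hP (by omega) (by omega) (by omega) hz (hcmem i)).2
    · have h4 : b i ≤ b j := by
        rcases h.eq_or_lt with h | h
        · rw [h]
        · have := hblt _ _ h; omega
      exact (ha.le_rootDefect hG hP (by omega) (by omega) (by omega) (hcmem i) hz).1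
  choose q hq using fun i => hG.exists_walk_length_eq_dist (c i) r
  -- `l i` is the last position at which the geodesic is within distance less than `K` of its own
  -- segment.
  have hlast (i : ℕ) : ∃ l, i < t → l ≤ (q i).length ∧
      (∃ z ∈ seg i, G.dist ((q i).getVert l) z < K) ∧
      ∀ s, l < s → s ≤ (q i).length → ∀ z ∈ seg i, K ≤ G.dist ((q i).getVert s) z := by
    classical
    let p : ℕ → Prop := fun s => ∃ z ∈ seg i, G.dist ((q i).getVert s) z < K
    refine ⟨Nat.findGreatest p (q i).length, fun hi => ⟨Nat.findGreatest_le _, ?_, ?_⟩⟩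
    · have h0 : p 0 := ⟨c i, hcseg i hi, by simpa using Nat.succ_le_iff.mp hK⟩
      exact Nat.findGreatest_spec (P := p) (Nat.zero_le _) h0
    · intro s hs hsl z hz
      have := Nat.findGreatest_is_greatest hs hsl
      by_contra! hlt
      exact this ⟨z, hz, hlt⟩
  choose l hl using hlast
  have hcross (i j : ℕ) (hi : i < t) (hj : j < t) (hij : i ≠ j) (s : ℕ) (hs : s ≤ l i + K) (s' : ℕ) :
      K ≤ G.dist ((q i).getVert s) ((q j).getVert s') := by
    obtain ⟨-, ⟨z, hz, hzl⟩, -⟩ := hl i hi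
    exact le_dist_of_le_rootDefect_of_dist_lt hG _ (hq i) _ (hq j) hzl (dseg i j hi hj hij z hz) hs s'
  -- Otherwise `q i` would have reached `r` by `l i + K`, where it meets any other geodesic, against
  -- `hcross`. A second geodesic exists since `t ≥ 2`.
  have hlen (i : ℕ) (hi : i < t) : l i + K ≤ (q i).length := by
    by_contra! hlt
    obtain ⟨j, hj, hij⟩ : ∃ j < t, i ≠ j := by
      rcases Nat.eq_zero_or_pos i with h | h
      · exact ⟨1, by omega, by omega⟩
      · exact ⟨0, by omega, by omega⟩
    have := hcross i j hi hj hij (l i + K) le_rfl (q j).length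
    rw [(q i).getVert_of_length_le hlt.le, (q j).getVert_length] at this
    simp at this
    omega
  have hqseg (i j : ℕ) (hi : i < t) (hj : j < t) (hij : i ≠ j) (I : Set ℕ) :
      SetsFar G K (seg i) ((q j).getVert '' I) := by
    rintro z hz _ ⟨s, -, rfl⟩
    rw [SimpleGraph.dist_comm]
    have := dseg i j hi hj hij z hz
    exact le_dist_of_le_rootDefect hG _ (hq j) (by push_cast at this ⊢; omega) s
  have hqrim (i j : ℕ) (hi : i < t) (hj : j + 1 < t) (I : Set ℕ) :
      SetsFar G K ((q i).getVert '' I) (rim j) := by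
    rintro _ ⟨s, -, rfl⟩ z hz
    exact le_dist_of_le_rootDefect hG _ (hq i) (drim i j hi hj z hz) s
  have hqq (i j : ℕ) (hi : i < t) (hj : j < t) (hij : i ≠ j) (u : ℕ) (v : ℕ) (hv : v ≤ l i + K)
      (I : Set ℕ) : SetsFar G K ((q i).getVert '' Set.Icc u v) ((q j).getVert '' I) := by
    rintro _ ⟨s, hs, rfl⟩ _ ⟨s', -, rfl⟩
    exact hcross i j hi hj hij s (hs.2.trans hv) s'
  have hhub {X : Set V} (hX : ∀ i < t,
      SetsFar G K ((q i).getVert '' Set.Icc (l i + K) (q i).length) X) :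
      SetsFar G K (⋃₀ {Y | ∃ i < t, Y = (q i).getVert '' Set.Icc (l i + K) (q i).length}) X := by
    rintro z ⟨_, ⟨i, hi, rfl⟩, hz⟩ w hw
    exact hX i hi z hz w hw
  have hrmem (i : ℕ) (hi : i < t) : r ∈ (q i).getVert '' Set.Icc (l i + K) (q i).length :=
    ⟨_, ⟨hlen i hi, le_rfl⟩, (q i).getVert_length⟩
  refine hasFatMinor_fan_of_sets hG
    (⋃₀ {Y | ∃ i < t, Y = (q i).getVert '' Set.Icc (l i + K) (q i).length})
    (fun i => seg i ∪ (q i).getVert '' Set.Icc 0 (l i))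
    (fun i => (q i).getVert '' Set.Icc (l i) (l i + K)) rim
    ?_ ?_ ?_ ?_ ?_ ?_ ?_ ?_ ?_ ?_ ?_ ?_ ?_ ?_ ?_ ?_
  · refine SimpleGraph.induce_sUnion_connected_of_pairwise_not_disjoint
      ⟨_, 0, by omega, rfl⟩ ?_ ?_
    · rintro _ _ ⟨i, hi, rfl⟩ ⟨j, hj, rfl⟩
      exact ⟨r, hrmem i hi, hrmem j hj⟩
    · rintro _ ⟨i, hi, rfl⟩
      exact induce_image_Icc_connected (getVert_succ_eq_or_adj _) (hlen i hi)
  · intro i hi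
    have := hbt i hi
    refine SimpleGraph.induce_union_connected
      (ha.segment_connected (by omega) (by omega)).preconnected
      (induce_image_Icc_connected (getVert_succ_eq_or_adj _) (Nat.zero_le _)).preconnected
      ⟨c i, hcseg i hi, 0, ⟨le_rfl, Nat.zero_le _⟩, (q i).getVert_zero⟩
  · intro i hi
    exact induce_image_Icc_connected (getVert_succ_eq_or_adj _) (by omega)
  · intro i hi
    have h1 := hb1 i
    have h2 := hbt _ hi
    exact ha.segment_connected (by omega) (by omega)
  · intro i hi
    exact ⟨(q i).getVert (l i + K), ⟨_, ⟨i, hi, rfl⟩, _, ⟨le_rfl, hlen i hi⟩, rfl⟩,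
      _, ⟨by omega, le_rfl⟩, rfl⟩
  · intro i hi
    exact ⟨(q i).getVert (l i), Or.inr ⟨_, ⟨Nat.zero_le _, le_rfl⟩, rfl⟩,
      _, ⟨le_rfl, by omega⟩, rfl⟩
  · intro i hi
    have h1 := hb1 i
    have h2 := hbt _ hi
    exact ⟨P.getVert (a (b i + 4 * K)),
      Or.inl ⟨_, ⟨(ha.growth (by omega) (by omega)).1, le_rfl⟩, rfl⟩,
      _, ⟨le_rfl, (ha.growth (by omega) (by omega)).1⟩, rfl⟩
  · intro i hi
    have h1 := hb1 i
    have h2 := hbt _ hi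
    exact ⟨P.getVert (a (b (i + 1))),
      Or.inl ⟨_, ⟨le_rfl, (ha.growth (by omega) (by omega)).1⟩, rfl⟩,
      _, ⟨(ha.growth (by omega) (by omega)).1, le_rfl⟩, rfl⟩
  · intro i hi
    refine hhub fun j hj => ?_
    rcases eq_or_ne i j with rfl | hij
    -- The tail avoids its own segment since `l i` is the last close position, and the start of its
    -- geodesic since the spoke has length `K`.
    · refine SetsFar.union_right ?_ ?_
      · rintro _ ⟨s, hs, rfl⟩ z hz
        exact (hl i hi).2.2 s (by have := hs.1; omega) hs.2 z hz
      · rintro _ ⟨s, hs, rfl⟩ _ ⟨s', hs', rfl⟩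
        have h1 := hs.1
        have h2 := hs'.2
        rw [SimpleGraph.dist_comm, dist_getVert hG _ (hq i) (by omega) hs.2]
        omega
    · exact (hqseg i j hi hj hij _).symm.union_right (hqq i j hi hj hij _ _ (by omega) _).symm
  · intro i hi j hj hij
    refine SetsFar.union_left (SetsFar.union_right ?_ (hqseg i j hi hj hij _))
      (SetsFar.union_right (hqseg j i hj hi hij.symm _).symm (hqq i j hi hj hij _ _ (by omega) _))
    have h1 := hbt i hi
    have h2 := hbt j hj
    rcases lt_or_gt_of_ne hij with h | h
    · have h3 := hblt i j h
      exact ha.setsFar_segment hG hP (by omega) (by omega) (by omega)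
    · have h3 := hblt j i h
      exact (ha.setsFar_segment hG hP (by omega) (by omega) (by omega)).symm
  · intro i hi j hj hij
    exact hqq i j hi hj hij _ _ le_rfl _
  · have key (i j : ℕ) (hj : j + 1 < t) (h : i < j) : SetsFar G K (rim i) (rim j) := by
      have h2 := hbt _ hj
      have h3 := hb1 j
      have h4 := hblt i j h
      have h5 := hb1 i
      exact ha.setsFar_segment hG hP (by omega) (by omega) (by omega)
    intro i j hi hj hij
    rcases lt_or_gt_of_ne hij with h | h
    · exact key i j hj h
    · exact (key j i hi h).symm
  · intro i j hi hj
    exact hqrim i j hi hj _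
  · intro j hj
    exact hhub fun i hi => hqrim i j hi hj _
  · intro i hi j hj hij
    exact (hqseg i j hi hj hij _).union_left (hqq i j hi hj hij _ _ (by omega) _)
  · intro i j hi hj hij hij'
    refine SetsFar.union_left ?_ (hqrim i j hi hj _)
    have h1 := hbt i hi
    have h2 := hbt _ hj
    have h3 := hb1 j
    rcases lt_or_gt_of_ne hij with h | h
    · have h4 := hblt i j h
      exact ha.setsFar_segment hG hP (by omega) (by omega) (by omega)
    · have h4 := hblt (j + 1) i (by omega)
      exact (ha.setsFar_segment hG hP (by omega) (by omega) (by omega)).symm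

/-! ### From antichain sets to antichain sequences -/

theorem hasDirectedPath_of_length_add_dist (hG : G.Connected) (r : V) {x y : V} (w : G.Walk x y)
    (hw : w.length + G.dist r y = G.dist r x) : HasDirectedPath (bfsDag G r) x y := by
  induction w with
  | nil => exact Relation.ReflTransGen.refl
  | @cons x z y hxz w ih =>
    rw [SimpleGraph.Walk.length_cons] at hw
    have h1 := hG.dist_triangle (u := r) (v := z) (w := x)
    have h2 := hG.dist_triangle (u := r) (v := y) (w := z)
    have h3 := SimpleGraph.dist_eq_one_iff_adj.mpr hxz.symm
    have h4 := SimpleGraph.dist_le w.reverse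
    rw [SimpleGraph.Walk.length_reverse] at h4
    exact Relation.ReflTransGen.head ⟨hxz, by omega⟩ (ih (by omega))

/-- If the distance to `r` changed by as much as the position between consecutive chosen vertices, a
geodesic joining them would be monotone towards `r`, hence a directed path. -/
theorem exists_isAntichainSeq (hG : G.Connected) {r x y : V} {P : G.Walk x y}
    (hP : P.length = G.dist x y) {S : Set V} (hS : ∀ z ∈ S, z ∈ P.support)
    (hanti : IsAntichainSet (bfsDag G r) S) {N : ℕ} (hN : (N : ℕ∞) ≤ S.encard) :
    ∃ a, IsAntichainSeq r P N a := by
  classical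
  obtain ⟨T, hTS, hT⟩ := Set.exists_subset_encard_eq hN
  have hpos : ∀ z ∈ T, P.getVert (G.dist x z) = z ∧ G.dist x z ≤ P.length := by
    intro z hz
    obtain ⟨i, rfl, hi⟩ := SimpleGraph.Walk.mem_support_iff_exists_getVert.mp (hS z (hTS hz))
    have := dist_getVert hG P hP (Nat.zero_le i) hi
    rw [P.getVert_zero, Nat.sub_zero] at this
    rw [this]
    exact ⟨rfl, hi⟩
  have hfin : T.Finite := Set.finite_of_encard_eq_coe hT
  have hcard : (hfin.toFinset.image (G.dist x)).card = N := by
    rw [Finset.card_image_of_injOn]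
    · rw [hfin.encard_eq_coe_toFinset_card] at hT
      exact_mod_cast hT
    · intro z hz z' hz' h
      rw [← (hpos z (by simpa using hz)).1, ← (hpos z' (by simpa using hz')).1]
      exact congrArg P.getVert h
  obtain ⟨a, ha, hlt⟩ : ∃ a : ℕ → ℕ, (∀ l < N, ∃ z ∈ T, G.dist x z = a l) ∧
      ∀ l, l + 1 < N → a l < a (l + 1) := by
    refine ⟨fun l => if h : l < N then Finset.orderEmbOfFin _ hcard ⟨l, h⟩ else 0, ?_, ?_⟩
    · intro l hl
      have := Finset.orderEmbOfFin_mem _ hcard ⟨l, hl⟩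
      rw [Finset.mem_image] at this
      obtain ⟨z, hz, h⟩ := this
      exact ⟨z, by simpa using hz, by simpa [hl] using h⟩
    · intro l hl
      simp [hl, show l < N by omega]
  have hmem : ∀ l < N, P.getVert (a l) ∈ S ∧ a l ≤ P.length := by
    intro l hl
    obtain ⟨z, hz, h⟩ := ha l hl
    have := hpos z hz
    rw [h] at this
    exact ⟨this.1.symm ▸ hTS hz, this.2⟩
  have hstep : ∀ l, l + 1 < N →
      (∃ w : G.Walk (P.getVert (a l)) (P.getVert (a (l + 1))), w.length = a (l + 1) - a l) ∧
      ¬ HasDirectedPath (bfsDag G r) (P.getVert (a l)) (P.getVert (a (l + 1))) ∧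
      ¬ HasDirectedPath (bfsDag G r) (P.getVert (a (l + 1))) (P.getVert (a l)) := by
    intro l hl
    have h1 := hmem l (by omega)
    have h2 := hmem (l + 1) hl
    have h3 := hlt l hl
    have h4 := dist_getVert hG P hP h3.le h2.2
    refine ⟨?_, hanti _ h1.1 _ h2.1 fun h => ?_⟩
    · rw [← h4]; exact hG.exists_walk_length_eq_dist _ _
    · rw [h, SimpleGraph.dist_self] at h4; omega
  refine ⟨a, fun l hl => (hmem l hl).2, fun l hl => ?_, fun l hl => ?_⟩ <;>
    obtain ⟨⟨w, hw⟩, h1, h2⟩ := hstep l hl <;> have h3 := hlt l hl <;> by_contra! hle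
  · have h4 := hG.dist_triangle (u := r) (v := P.getVert (a l)) (w := P.getVert (a (l + 1)))
    have h5 := SimpleGraph.dist_le w
    refine h2 (hasDirectedPath_of_length_add_dist hG r w.reverse ?_)
    rw [SimpleGraph.Walk.length_reverse]
    omega
  · have h4 := hG.dist_triangle (u := r) (v := P.getVert (a (l + 1))) (w := P.getVert (a l))
    have h5 := SimpleGraph.dist_le w.reverse
    rw [SimpleGraph.Walk.length_reverse] at h5
    refine h1 (hasDirectedPath_of_length_add_dist hG r w ?_)
    omega

/-! ### Covering by rooted geodesics -/

/-- For two monotone sequences, an initial segment of `ℕ` contains a sequence of positions along which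
both increase strictly, or it is covered by few intervals on each of which one of them is constant. -/
theorem exists_strict_seq_or_interval_cover {u v : ℕ → ℤ} (hu : Monotone u) (hv : Monotone v)
    (n k s : ℕ) :
    (∃ a : ℕ → ℕ, a 0 = s ∧ (∀ l ≤ k, a l ≤ n) ∧
      ∀ l < k, u (a l) < u (a (l + 1)) ∧ v (a l) < v (a (l + 1))) ∨
    ∃ b c : ℕ → ℕ, (∀ m < k, b m ≤ c m ∧ c m ≤ n ∧ (u (b m) = u (c m) ∨ v (b m) = v (c m))) ∧
      ∀ i, s ≤ i → i ≤ n → ∃ m < k, b m ≤ i ∧ i ≤ c m := by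
  classical
  induction k generalizing s with
  | zero =>
    rcases le_or_gt s n with h | h
    · exact Or.inl ⟨fun _ => s, rfl, fun _ _ => h, by simp⟩
    · exact Or.inr ⟨fun _ => 0, fun _ => 0, by simp, fun i h1 h2 => by omega⟩
  | succ k ih =>
    rcases le_or_gt s n with hs | hs
    swap
    -- Nothing is left to cover; the intervals are dummies.
    · exact Or.inr ⟨fun _ => 0, fun _ => 0, by simp, fun i h1 h2 => by omega⟩
    have hconst : ∀ i, s ≤ i → ¬ (u s < u i ∧ v s < v i) → u s = u i ∨ v s = v i := by
      intro i hi h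
      have h1 := hu hi
      have h2 := hv hi
      omega
    -- Greedy step: jump to the first `j` where both sequences exceed their values at `s`. By
    -- minimality one of them is still constant on `[s, j - 1]`, which becomes the first interval.
    by_cases hex : ∃ j, s ≤ j ∧ j ≤ n ∧ u s < u j ∧ v s < v j
    · obtain ⟨hj1, hj2, hj3⟩ := Nat.find_spec hex
      have hmin := fun i => @Nat.find_min _ _ hex i
      generalize Nat.find hex = j at hj1 hj2 hj3 hmin
      have hsj : s < j := by
        rcases hj1.eq_or_lt with rfl | h
        · exact absurd hj3.1 (lt_irrefl _)
        · exact h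
      rcases ih j with ⟨a, ha0, ha1, ha2⟩ | ⟨b, c, hbc, hcov⟩
      · refine Or.inl ⟨fun l => if l = 0 then s else a (l - 1), rfl, ?_, ?_⟩
        · rintro (_ | l) hl
          · exact hs
          · exact ha1 l (by omega)
        · rintro (_ | l) hl
          · simpa [ha0] using hj3
          · simpa using ha2 l (by omega)
      · refine Or.inr ⟨fun m => if m = 0 then s else b (m - 1),
          fun m => if m = 0 then j - 1 else c (m - 1), ?_, ?_⟩
        · rintro (_ | m) hm
          · refine ⟨by simp; omega, by simp; omega, ?_⟩
            exact hconst (j - 1) (by omega) fun h =>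
              hmin (j - 1) (by omega) ⟨by omega, by omega, h⟩
          · simpa using hbc m (by omega)
        · intro i hi hin
          rcases lt_or_ge i j with h | h
          · exact ⟨0, by omega, by simpa using hi, by simp; omega⟩
          · obtain ⟨m, hm, h1⟩ := hcov i h hin
            exact ⟨m + 1, by omega, by simpa using h1⟩
    · refine Or.inr ⟨fun _ => s, fun _ => n, fun _ _ => ⟨hs, le_rfl, ?_⟩,
        fun i h1 h2 => ⟨0, by omega, h1, h2⟩⟩
      exact hconst n hs fun h => hex ⟨n, hs, le_rfl, h⟩

theorem exists_isRootedIsometricPath (hG : G.Connected) (r : V) {x y : V} (w : G.Walk x y)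
    (hw : w.length + G.dist r y = G.dist r x) :
    ∃ Q : G.Walk x r, IsRootedIsometricPath r Q ∧ ∀ z ∈ w.support, z ∈ Q.support := by
  obtain ⟨w', hw'⟩ := hG.exists_walk_length_eq_dist y r
  have hlen : (w.append w').length = G.dist x r := by
    rw [SimpleGraph.Walk.length_append, hw', SimpleGraph.dist_comm, hw, SimpleGraph.dist_comm]
  refine ⟨w.append w', ⟨⟨SimpleGraph.Walk.isPath_of_length_eq_dist _ hlen, hlen⟩, Or.inr rfl⟩, ?_⟩
  intro z hz
  rw [SimpleGraph.Walk.mem_support_append_iff]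
  exact Or.inl hz

theorem exists_walk_getVert {x y : V} (P : G.Walk x y) {b c : ℕ} (hbc : b ≤ c)
    (hc : c ≤ P.length) :
    ∃ w : G.Walk (P.getVert b) (P.getVert c), w.length = c - b ∧
      ∀ i, b ≤ i → i ≤ c → P.getVert i ∈ w.support := by
  have h : (P.drop b).getVert (c - b) = P.getVert c := by
    rw [SimpleGraph.Walk.drop_getVert]; congr; omega
  refine ⟨((P.drop b).take (c - b)).copy rfl h, ?_, ?_⟩
  · rw [SimpleGraph.Walk.length_copy, SimpleGraph.Walk.take_length, SimpleGraph.Walk.drop_length]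
    omega
  · intro i h1 h2
    rw [SimpleGraph.Walk.support_copy]
    have hi : P.getVert i = ((P.drop b).take (c - b)).getVert (i - b) := by
      rw [SimpleGraph.Walk.take_getVert, SimpleGraph.Walk.drop_getVert,
        show b + (c - b) ⊓ (i - b) = i by omega]
    rw [hi]
    exact SimpleGraph.Walk.getVert_mem_support _ _

/-- The greedy dichotomy is applied to position minus and plus the distance to `r`. With `k =
(12K+5)t - 1`, the first alternative has `k + 1` positions, enough for a fat fan, while the second
uses only `k` intervals. -/
theorem rootCoverable_of_not_hasFatMinor (hG : G.Connected) {K t : ℕ} (hK : 1 ≤ K) (ht : 2 ≤ t)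
    (h : ¬ HasFatMinor K (fan t) G) (r : V) : RootCoverable G r ((12 * K + 5) * t - 1) := by
  rintro x y P ⟨-, hP⟩
  have hpos : 0 < (12 * K + 5) * t := by positivity
  have hstep : ∀ i, G.dist r (P.getVert i) ≤ G.dist r (P.getVert (i + 1)) + 1 ∧
      G.dist r (P.getVert (i + 1)) ≤ G.dist r (P.getVert i) + 1 := by
    intro i
    rcases getVert_succ_eq_or_adj P i with h | h
    · rw [h]; omega
    · have h1 := h.diff_dist_adj (u := r)
      omega
  have hu : Monotone fun i : ℕ => (i : ℤ) - G.dist r (P.getVert i) :=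
    monotone_nat_of_le_succ fun i => by have := hstep i; push_cast; omega
  have hv : Monotone fun i : ℕ => (i : ℤ) + G.dist r (P.getVert i) :=
    monotone_nat_of_le_succ fun i => by have := hstep i; push_cast; omega
  rcases exists_strict_seq_or_interval_cover hu hv P.length ((12 * K + 5) * t - 1) 0 with
    ⟨a, -, ha1, ha2⟩ | ⟨b, c, hbc, hcov⟩
  · refine absurd (hasFatMinor_fan_of_isAntichainSeq hG hP hK ht (r := r) (a := a)
      ⟨fun l hl => ha1 l (by omega), fun l hl => ?_, fun l hl => ?_⟩) h <;>
    · have := ha2 l (by omega)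
      omega
  · have hQ : ∀ m : Fin ((12 * K + 5) * t - 1), ∃ (p : V) (Q : G.Walk p r),
        IsRootedIsometricPath r Q ∧ ∀ i, b m ≤ i → i ≤ c m → P.getVert i ∈ Q.support := by
      intro m
      obtain ⟨h1, h2, h3⟩ := hbc m m.2
      obtain ⟨w, hw, hcw⟩ := exists_walk_getVert P h1 h2
      -- Constant difference means that `P` runs straight away from `r`, so the piece is reversed;
      -- constant sum means that it runs straight towards `r`.
      rcases h3 with h3 | h3
      · obtain ⟨Q, hQ, hsub⟩ := exists_isRootedIsometricPath hG r w.reverse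
          (by rw [SimpleGraph.Walk.length_reverse]; omega)
        exact ⟨_, Q, hQ, fun i hi hi' => hsub _ (by simpa using hcw i hi hi')⟩
      · obtain ⟨Q, hQ, hsub⟩ := exists_isRootedIsometricPath hG r w (by omega)
        exact ⟨_, Q, hQ, fun i hi hi' => hsub _ (hcw i hi hi')⟩
    choose p Q hQ hcQ using hQ
    refine ⟨p, fun _ => r, Q, hQ, fun z hz => ?_⟩
    obtain ⟨i, rfl, hi⟩ := SimpleGraph.Walk.mem_support_iff_exists_getVert.mp hz
    obtain ⟨m, hm, h1, h2⟩ := hcov i (Nat.zero_le i) hi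
    exact ⟨⟨m, hm⟩, hcQ ⟨m, hm⟩ i h1 h2⟩

theorem antichainNumber_le_of_not_hasFatMinor (hG : G.Connected) {K t : ℕ} (hK : 1 ≤ K)
    (ht : 2 ≤ t) (h : ¬ HasFatMinor K (fan t) G) (r : V) :
    antichainNumber G r ≤ (((12 * K + 5) * t - 1 : ℕ) : ℕ∞) := by
  have hpos : 0 < (12 * K + 5) * t := by positivity
  refine iSup_le fun x => iSup_le fun y => iSup_le fun P => iSup_le fun hP => iSup_le fun S =>
    iSup_le fun hS => ?_
  by_contra! hlt
  have hN := Order.add_one_le_of_lt hlt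
  rw [← Nat.cast_add_one, Nat.sub_add_cancel hpos] at hN
  obtain ⟨a, ha⟩ := exists_isAntichainSeq hG hP.2 hS.1 hS.2 hN
  exact h (hasFatMinor_fan_of_isAntichainSeq hG hP.2 hK ht ha)

/-! ### Monotonicity of fat minors and the conclusion -/

theorem HasFatMinor.of_injective_hom {W W' : Type*} {H : SimpleGraph W} {H' : SimpleGraph W'}
    (f : H →g H') (hf : Function.Injective f) {K K' : ℕ} (hK : K ≤ K') (h : HasFatMinor K' H' G) :
    HasFatMinor K H G := by
  obtain ⟨M⟩ := h
  have hfar {X Y : G.Subgraph} (h : FarApart G K' X Y) : FarApart G K X Y :=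
    fun x hx y hy => (Nat.cast_le.mpr hK).trans (h x hx y hy)
  refine ⟨{
    branchSet := fun w => M.branchSet (f w)
    branchPath := fun e => M.branchPath (f.mapEdgeSet e)
    branchSet_connected := fun w => M.branchSet_connected _
    branchPath_connected := fun e => M.branchPath_connected _
    incident := fun w e hw => M.incident _ _ (Sym2.mem_map.mpr ⟨w, hw, rfl⟩)
    far_sets := fun w w' hne => hfar (M.far_sets _ _ (hf.ne hne))
    far_paths := fun e e' hne =>
      hfar (M.far_paths _ _ ((SimpleGraph.Hom.mapEdgeSet.injective f hf).ne hne))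
    far_set_path := fun w e hw => hfar (M.far_set_path _ _ fun hmem => hw ?_) }⟩
  obtain ⟨w', hw', h⟩ := Sym2.mem_map.mp hmem
  exact hf h ▸ hw'

theorem HasFatMinor.fan_mono {K K' t t' : ℕ} (hK : K ≤ K') (ht : t ≤ t')
    (h : HasFatMinor K' (fan t') G) : HasFatMinor K (fan t) G := by
  refine h.of_injective_hom ⟨Option.map (Fin.castLE ht), ?_⟩
    (Option.map_injective (Fin.castLE_injective ht)) hK
  rintro (_ | i) (_ | j) hij
  · exact hij
  · trivial
  · trivial
  · have hij : (SimpleGraph.pathGraph t).Adj i j := hij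
    rw [SimpleGraph.pathGraph_adj] at hij
    exact SimpleGraph.pathGraph_adj.mpr hij

end CoarseGraph

theorem theorem1 :
    (∃ f : ℕ → ℕ → ℕ, ∀ (K t : ℕ) (V : Type*) [Finite V] (G : SimpleGraph V), G.Connected →
      ¬ CoarseGraph.HasFatMinor K (CoarseGraph.fan t) G →
        CoarseGraph.strongIsometricPathComplexity G ≤ (f K t : ℕ∞)) ∧
    (∀ (K t : ℕ), 5 ≤ K → 2 ≤ t →
      ∀ (V : Type*) [Finite V] (G : SimpleGraph V), G.Connected →
      ¬ CoarseGraph.HasFatMinor K (CoarseGraph.fan t) G → ∀ r : V,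
        CoarseGraph.antichainNumber G r ≤ (((12 * K + 5) * t - 1 : ℕ) : ℕ∞) ∧
        CoarseGraph.rootCoverNumber G r ≤ (((12 * K + 5) * t - 1 : ℕ) : ℕ∞)) := by
  -- The maxima supply `K ≥ 1` and `t ≥ 2`; `fan_mono` shows that raising the parameters still
  -- excludes the fan.
  refine ⟨⟨fun K t => (12 * max K 1 + 5) * max t 2 - 1, fun K t V _ G hG h => ?_⟩,
    fun K t hK ht V _ G hG h r => ⟨?_, ?_⟩⟩
  · exact iInf₂_le _ fun r => CoarseGraph.rootCoverable_of_not_hasFatMinor hG (le_max_right _ _)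
      (le_max_right _ _) (fun h' => h (h'.fan_mono (le_max_left _ _) (le_max_left _ _))) r
  · exact CoarseGraph.antichainNumber_le_of_not_hasFatMinor hG (by omega) ht h r
  · exact iInf₂_le _ (CoarseGraph.rootCoverable_of_not_hasFatMinor hG (by omega) ht h r)
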